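/- Throughout, a Borel space is a separable metrizable space that is homeomorphic to a Borel subset of a complete separable metric space; it carries its Borel σ-algebra. For a Borel space $X$, $\mathcal M_{\mathbb P}(X)$ is the set of Borel probability measures on $X$ with the topology of weak convergence. **Original MDP.** Let $\alpha\in[0,1)$ and let $(\mathcal S,\mathcal U,\{\mathcal U(s)\mid s\in\mathcal S\},Q,r)$ be a Markov decision model: $\mathcal S$, $\mathcal U$ are Borel spaces; the sets $\mathcal U(s)\subseteq\mathcal U$ are nonempty; $\mathbb K=\{(s,u): u\in\mathcal U(s)\}$ is a Borel subset of $\mathcal S\times\mathcal U$; $Q$ is a stochastic kernel on $\mathcal S$ given $\mathbb K$; $r:\mathbb K\to\mathbb R$ is measurable. For a randomized history-dependent policy $\pi$, let $V(\pi,s)=\mathbb E_s^\pi\big[\sum_{t\ge0}\alpha^t r(s_t,u_t)\big]$. Assume: 1. $r$ is upper semicontinuous on $\mathbb K$, bounded above, and sup-compact, i.e. $\{u\in\mathcal U(s): r(s,u)\ge c\}$ is compact for all $s\in\mathcal S$, $c\in\mathbb R$; 2. $Q$ is strongly continuous: $(s,u)\mapsto\int g(s')\,Q(ds'|s,u)$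 is continuous and bounded on $\mathbb K$ for every bounded measurable $g:\mathcal S\to\mathbb R$; 3. there is a policy $\pi$ with $V(\pi,s)<\infty$ for every $s\in\mathcal S$; 4. $r$ is bounded below; 5. $\mathbb K_{\mathcal C}=\{(s,u)\in\mathbb K: s\in\mathcal C\}$ is compact for every compact $\mathcal C\subseteq\mathcal S$. **Measurized MDP.** Let $\Phi$ be the set of stochastic kernels $\varphi$ on $\mathcal U$ given $\mathcal S$ with $\varphi(\mathcal U(s)|s)=1$ for all $s$. For $\nu\in\mathcal M_{\mathbb P}(\mathcal S)$ and $\varphi\in\Phi$ let $\gamma_{\nu,\varphi}(ds,du)=\varphi(du|s)\,\nu(ds)\in\mathcal M_{\mathbb P}(\mathcal S\times\mathcal U)$, and put $$\overline r(\nu,\varphi)=\int_{\mathcal S}\int_{\mathcal U} r(s,u)\,\varphi(du|s)\,\nu(ds),\qquad F(\nu,\varphi)(\cdot)=\int_{\mathcal S}\int_{\mathcal U} Q(\cdot|s,u)\,\varphi(du|s)\,\nu(ds).$$ The set $\mathcal M_{\mathbb P}(\mathcal S)\times\Phi$ carries the topology induced by $(\nu,\varphi)\mapsto\gamma_{\nu,\varphi}$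 (so $(\nu_n,\varphi_n)\to(\nu,\varphi)$ means that $\gamma_{\nu_n,\varphi_n}\to\gamma_{\nu,\varphi}$ weakly) and its Borel σ-algebra; for fixed $\nu$, $\Phi$ carries the topology induced by $\varphi\mapsto\gamma_{\nu,\varphi}$. Let $\Phi(\nu)\subseteq\Phi$ be nonempty for every $\nu\in\mathcal M_{\mathbb P}(\mathcal S)$, such that $\overline{\mathbb K}=\{(\nu,\varphi):\varphi\in\Phi(\nu)\}$ is a Borel subset of $\mathcal M_{\mathbb P}(\mathcal S)\times\Phi$. The measurized MDP $(\mathcal M_{\mathbb P}(\mathcal S),\Phi,\{\Phi(\nu)\},\overline q,\overline r)$ has feasible state-action pairs $\overline{\mathbb K}$, reward $\overline r$ and the deterministic transition kernel $\overline q(\cdot|\nu,\varphi)=\delta_{F(\nu,\varphi)}$. **Proposition.** If, for every $\nu\in\mathcal M_{\mathbb P}(\mathcal S)$, $\Phi(\nu)$ is closed in $\Phi$ (in the topology of $\Phi$ at $\nu$), then - $\overline r$ is upper semicontinuous on $\overline{\mathbb K}$, bounded above, and sup-compact, i.e. $\{\varphi\in\Phi(\nu):\overline r(\nu,\varphi)\ge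 c\}$ is compact (in the topology of $\Phi$ at $\nu$) for all $\nu$ and $c\in\mathbb R$; - $\overline q$ is weakly continuous: $(\nu,\varphi)\mapsto\int g\,d\overline q(\cdot|\nu,\varphi)$ is continuous and bounded on $\overline{\mathbb K}$ for every bounded continuous $g:\mathcal M_{\mathbb P}(\mathcal S)\to\mathbb R$; - there is a randomized history-dependent policy $\overline\pi$ of the measurized MDP whose discounted value $\overline V(\overline\pi,\nu)=\mathbb E_\nu^{\overline\pi}\big[\sum_{t\ge0}\alpha^t\,\overline r(\nu_t,\varphi_t)\big]$ is finite, in particular $\overline V(\overline\pi,\nu)<\infty$, for every $\nu\in\mathcal M_{\mathbb P}(\mathcal S)$. -/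

import Mathlib

open MeasureTheory ProbabilityTheory Topology TopologicalSpace
open scoped ENNReal

noncomputable section

namespace MarkovDecision

set_option linter.unusedSectionVars false

universe u v

section General

variable {X : Type u} {A : Type v}

/-- The set `{(x, a) | a ∈ feasible x}` of feasible state-action pairs, as a space. It carries the
subspace topology of the given topology `τ` on `X × A`, and the Borel σ-algebra of that topology. -/
@[nolint unusedArguments]
def Pairs (_τ : TopologicalSpace (X × A)) (feasible : X → Set A) : Type (max u v) :=
  {p : X × A // p.2 ∈ feasible p.1}

/-- The inclusion of the feasible pairs into `X × A`. -/
def Pairs.toProd {τ : TopologicalSpace (X × A)} {feasible : X → Set A} :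
    Pairs τ feasible → X × A := Subtype.val

instance (τ : TopologicalSpace (X × A)) (feasible : X → Set A) :
    TopologicalSpace (Pairs τ feasible) :=
  @instTopologicalSpaceSubtype (X × A) (fun p => p.2 ∈ feasible p.1) τ

instance (τ : TopologicalSpace (X × A)) (feasible : X → Set A) :
    MeasurableSpace (Pairs τ feasible) :=
  borel (Pairs τ feasible)

instance (τ : TopologicalSpace (X × A)) (feasible : X → Set A) :
    BorelSpace (Pairs τ feasible) := ⟨rfl⟩

/-- The topology that the actions inherit from the topology `τ` on the pairs when the state is frozen
at `x`, through `a ↦ (x, a)`. -/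
@[reducible]
def actionTopology (τ : TopologicalSpace (X × A)) (x : X) : TopologicalSpace A :=
  TopologicalSpace.induced (fun a => (x, a)) τ

/-- A Markov decision model `(X, A, {A(x)}, Q, r)`. The topology `τ` on the state-action pairs is a
parameter: it is the product topology for a standard model, but not for a lifted one. -/
structure DecisionModel (X : Type u) (A : Type v) [MeasurableSpace X]
    (τ : TopologicalSpace (X × A)) where
  /-- the set `A(x)` of feasible actions in state `x` -/
  feasible : X → Set A
  feasible_nonempty : ∀ x, (feasible x).Nonempty
  measurableSet_pairs : MeasurableSet[@borel (X × A) τ] {p : X × A | p.2 ∈ feasible p.1}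
  /-- the transition law `Q(· | x, a)`, a stochastic kernel on `X` given the feasible pairs -/
  kernel : Kernel (Pairs τ feasible) X
  isMarkovKernel : IsMarkovKernel kernel
  /-- the one-stage reward `r(x, a)` on the feasible pairs -/
  reward : Pairs τ feasible → ℝ
  measurable_reward : Measurable reward

namespace DecisionModel

variable [MeasurableSpace X] {τ : TopologicalSpace (X × A)} (M : DecisionModel X A τ)

/-- The space `𝕂` of feasible state-action pairs of the model. -/
abbrev K : Type (max u v) := Pairs τ M.feasible

instance : IsMarkovKernel M.kernel := M.isMarkovKernel

/-! ### Policies and the discounted value -/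

/-- Histories `(k₀, …, k_{t-1}, x_t)` with feasible pairs `k_i = (x_i, a_i)`. -/
abbrev History (t : ℕ) : Type (max u v) := (Fin t → M.K) × X

/-- A randomized history-dependent policy. Given the history `h_t`, the (random) feasible action
is recorded together with the current state, i.e. as a law on feasible pairs that is concentrated
on the pairs whose state is the current one, `x_t`. -/
structure Policy where
  act : ∀ t : ℕ, Kernel (M.History t) M.K
  isMarkovKernel : ∀ t, IsMarkovKernel (act t)
  state_eq : ∀ (t : ℕ) (h : M.History t), ∀ᵐ k ∂(act t h), k.1.1 = h.2

variable {M}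

namespace Policy

variable (π : M.Policy)

instance (t : ℕ) : IsMarkovKernel (π.act t) := π.isMarkovKernel t

/-- The conditional law of the pair `k_{t+1}` given `k₀, …, k_t`: the state `x_{t+1}` is drawn from
`Q(· | k_t)`, and then the action from the policy given the history `(k₀, …, k_t, x_{t+1})`. -/
def step (t : ℕ) : Kernel ((_i : Finset.Iic t) → M.K) M.K :=
  π.act (t + 1) ∘ₖ
    (Kernel.deterministic
        (fun (h : (_i : Finset.Iic t) → M.K) (i : Fin (t + 1)) =>
          h ⟨i, Finset.mem_Iic.2 (Nat.lt_succ_iff.1 i.2)⟩)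
        (by fun_prop) ×ₖ
      M.kernel.comap
        (fun (h : (_i : Finset.Iic t) → M.K) => h ⟨t, Finset.mem_Iic.2 le_rfl⟩)
        (by fun_prop))

instance (t : ℕ) : IsMarkovKernel (π.step t) := by
  unfold step
  infer_instance

/-- The law of the first pair `k₀ = (x₀, a₀)` when `x₀ = x`. -/
def initial (x : X) : Measure M.K := π.act 0 (Fin.elim0, x)

/-- The law `P_x^π` of the sequence `(x_t, a_t)_{t ≥ 0}` of state-action pairs under the policy `π`
from the initial state `x` (theorem of Ionescu-Tulcea). -/
def pathLaw (x : X) : Measure (ℕ → M.K) :=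
  Kernel.trajMeasure (X := fun _ => M.K) (π.initial x) π.step

/-- The discounted value `V(π, x) = E_x^π [∑ α^t r(x_t, a_t)]` as an extended real number: the
expected discounted sum of the positive parts of the rewards minus that of the negative parts. -/
def value (α : ℝ) (x : X) : EReal :=
  ((∫⁻ ω, ∑' t, ENNReal.ofReal (α ^ t * M.reward (ω t)) ∂(π.pathLaw x) : ℝ≥0∞) : EReal) -
    ((∫⁻ ω, ∑' t, ENNReal.ofReal (-(α ^ t * M.reward (ω t))) ∂(π.pathLaw x) : ℝ≥0∞) : EReal)

end Policy

/-! ### The assumptions -/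

variable (M)

/-- `r` is sup-compact: `{a ∈ A(x) | r(x, a) ≥ c}` is compact for every state `x` and real `c`. -/
def SupCompact : Prop :=
  ∀ (x : X) (c : ℝ), @IsCompact A (actionTopology τ x)
    {a : A | ∃ h : a ∈ M.feasible x, c ≤ M.reward ⟨(x, a), h⟩}

/-- The one-stage reward is u.s.c., bounded above and sup-compact on the feasible pairs. -/
structure RewardRegular : Prop where
  upperSemicontinuous : UpperSemicontinuous M.reward
  bddAbove : BddAbove (Set.range M.reward)
  supCompact : M.SupCompact

/-- `k ↦ ∫ g dQ(· | k)` is continuous and bounded for every measurable and bounded `g`. -/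
def StronglyContinuous : Prop :=
  ∀ g : X → ℝ, Measurable g → (∃ C, ∀ x, |g x| ≤ C) →
    Continuous (fun k => ∫ y, g y ∂(M.kernel k)) ∧ ∃ C, ∀ k, |∫ y, g y ∂(M.kernel k)| ≤ C

/-- `k ↦ ∫ g dQ(· | k)` is continuous and bounded for every continuous and bounded `g`. -/
def WeaklyContinuous [TopologicalSpace X] : Prop :=
  ∀ g : X → ℝ, Continuous g → (∃ C, ∀ x, |g x| ≤ C) →
    Continuous (fun k => ∫ y, g y ∂(M.kernel k)) ∧ ∃ C, ∀ k, |∫ y, g y ∂(M.kernel k)| ≤ C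

/-- There is a policy `π` with `V(π, x) < ∞` for every state `x`. -/
def HasFiniteValuePolicy (α : ℝ) : Prop :=
  ∃ π : M.Policy, ∀ x, π.value α x < ⊤

/-- `𝕂_C = {(x, a) ∈ 𝕂 | x ∈ C}` is compact for every compact set `C` of states. -/
def CompactOverCompacts [TopologicalSpace X] : Prop :=
  ∀ C : Set X, IsCompact C → @IsCompact (X × A) τ {p : X × A | p.2 ∈ M.feasible p.1 ∧ p.1 ∈ C}

end DecisionModel

end General

/-! ### Lifting a standard model to probability measures

The state space `S` and the action space `U` are Borel spaces: separable metrizable spaces whose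
Borel σ-algebra is standard, i.e. (up to homeomorphism) Borel subsets of Polish spaces. -/

section Lift

/-- With the product topology on the pairs, the actions carry their own topology in every state. -/
theorem actionTopology_prod {X : Type u} {A : Type v} [TopologicalSpace X]
    [tA : TopologicalSpace A] (x : X) :
    actionTopology (instTopologicalSpaceProd : TopologicalSpace (X × A)) x = tA :=
  (isInducing_prodMkRight x).eq_induced.symm

variable {S : Type u} {U : Type v}
  [TopologicalSpace S] [MetrizableSpace S] [SecondCountableTopology S] [MeasurableSpace S] [BorelSpace S]
  [TopologicalSpace U] [MetrizableSpace U] [SecondCountableTopology U] [MeasurableSpace U] [BorelSpace U]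

/-- A standard Markov decision model: the pairs carry the product topology. -/
abbrev StandardModel (S : Type u) (U : Type v) [TopologicalSpace S] [MeasurableSpace S]
    [TopologicalSpace U] : Type (max u v) :=
  DecisionModel S U (instTopologicalSpaceProd : TopologicalSpace (S × U))

namespace StandardModel

theorem measurableEmbedding_toProd (M : StandardModel S U) :
    MeasurableEmbedding (Pairs.toProd : M.K → S × U) := by
  have h : MeasurableSet {p : S × U | p.2 ∈ M.feasible p.1} := by
    have := M.measurableSet_pairs
    rwa [← BorelSpace.measurable_eq] at this
  have he : IsEmbedding (Pairs.toProd : M.K → S × U) := ⟨⟨rfl⟩, Subtype.val_injective⟩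
  refine he.measurableEmbedding ?_
  have e : Set.range (Pairs.toProd : M.K → S × U) = {p : S × U | p.2 ∈ M.feasible p.1} :=
    Subtype.range_val
  rw [e]
  exact h

/-- The set `Φ` of feasible Markov decision rules: stochastic kernels `φ` on `U` given `S` with
`φ(U(s) | s) = 1` for all `s`. -/
def DecisionRule (M : StandardModel S U) : Type (max u v) :=
  {φ : Kernel S U // IsMarkovKernel φ ∧ ∀ s, φ s (M.feasible s) = 1}

variable (M : StandardModel S U)

instance (φ : DecisionRule M) : IsMarkovKernel φ.1 := φ.2.1

/-- The law `γ(ds, du) = φ(du | s) ν(ds)` of a state-action pair when the state has law `ν` and the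
action is chosen by the rule `φ`. -/
def jointLaw (ν : ProbabilityMeasure S) (φ : DecisionRule M) : ProbabilityMeasure (S × U) :=
  ⟨(ν : Measure S) ⊗ₘ φ.1, inferInstance⟩

/-- The topology on the pairs `(ν, φ)`: `(ν_i, φ_i)` converges to `(ν, φ)` when the joint laws of
state and action converge weakly. -/
@[reducible]
def liftTopology : TopologicalSpace (ProbabilityMeasure S × DecisionRule M) :=
  TopologicalSpace.induced (fun p => jointLaw M p.1 p.2) inferInstance

/-- The joint law of state and action, as a measure on the feasible pairs. -/
def pairLaw (ν : ProbabilityMeasure S) (φ : DecisionRule M) : Measure M.K :=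
  (jointLaw M ν φ : Measure (S × U)).comap Pairs.toProd

theorem ae_feasible (ν : ProbabilityMeasure S) (φ : DecisionRule M) :
    ∀ᵐ p ∂(jointLaw M ν φ : Measure (S × U)), p.2 ∈ M.feasible p.1 := by
  have h := (measurableEmbedding_toProd M).measurableSet_range
  have e : Set.range (Pairs.toProd : M.K → S × U) = {p : S × U | p.2 ∈ M.feasible p.1} :=
    Subtype.range_val
  rw [e] at h
  refine (Measure.ae_compProd_iff h).2 (Filter.Eventually.of_forall fun s => ?_)
  have hs : MeasurableSet (M.feasible s) := h.preimage measurable_prodMk_left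
  exact (prob_compl_eq_zero_iff hs).2 (φ.2.2 s)

instance (ν : ProbabilityMeasure S) (φ : DecisionRule M) :
    IsProbabilityMeasure (pairLaw M ν φ) := by
  have hr : ∀ᵐ p ∂(jointLaw M ν φ : Measure (S × U)),
      p ∈ Set.range (Pairs.toProd : M.K → S × U) := by
    filter_upwards [ae_feasible M ν φ] with p hp using ⟨⟨p, hp⟩, rfl⟩
  unfold pairLaw
  exact (measurableEmbedding_toProd M).isProbabilityMeasure_comap hr

/-- The next state `F(ν, φ) = ∫∫ Q(· | s, u) φ(du | s) ν(ds)`. -/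
def transition (ν : ProbabilityMeasure S) (φ : DecisionRule M) : ProbabilityMeasure S :=
  ⟨M.kernel ∘ₘ pairLaw M ν φ, inferInstance⟩

/-- The lifted reward `∫∫ r(s, u) φ(du | s) ν(ds)`. -/
def liftReward (ν : ProbabilityMeasure S) (φ : DecisionRule M) : ℝ :=
  ∫ k, M.reward k ∂(pairLaw M ν φ)

theorem lintegral_pairLaw (ν : ProbabilityMeasure S) (φ : DecisionRule M) (f : M.K → ℝ≥0∞)
    (hf : Measurable f) :
    ∫⁻ k, f k ∂(pairLaw M ν φ) =
      ∫⁻ s, ∫⁻ u, Function.extend Pairs.toProd f 0 (s, u) ∂(φ.1 s) ∂(ν : Measure S) := by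
  have e := measurableEmbedding_toProd M
  have hg : Measurable (Function.extend (Pairs.toProd : M.K → S × U) f 0) :=
    e.measurable_extend hf measurable_zero
  have hr : ∀ᵐ p ∂(jointLaw M ν φ : Measure (S × U)),
      p ∈ Set.range (Pairs.toProd : M.K → S × U) := by
    filter_upwards [ae_feasible M ν φ] with p hp using ⟨⟨p, hp⟩, rfl⟩
  have h1 := Measure.lintegral_compProd (μ := (ν : Measure S)) (κ := φ.1) hg
  rw [← h1]
  have h2 : (pairLaw M ν φ).map Pairs.toProd = (jointLaw M ν φ : Measure (S × U)) := by
    unfold pairLaw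
    rw [e.map_comap, Measure.restrict_eq_self_of_ae_mem hr]
  change _ = ∫⁻ p, _ ∂(jointLaw M ν φ : Measure (S × U))
  rw [← h2, e.lintegral_map]
  exact lintegral_congr fun k => (e.injective.extend_apply f 0 k).symm

/-- `F(ν, φ)(B) = ∫∫ Q(B | s, u) φ(du | s) ν(ds)`. -/
theorem transition_apply (ν : ProbabilityMeasure S) (φ : DecisionRule M) {B : Set S}
    (hB : MeasurableSet B) :
    (transition M ν φ : Measure S) B =
      ∫⁻ s, ∫⁻ u, Function.extend Pairs.toProd (fun k : M.K => M.kernel k B) 0 (s, u)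
        ∂(φ.1 s) ∂(ν : Measure S) := by
  rw [← lintegral_pairLaw M ν φ _ (M.kernel.measurable_coe hB)]
  exact Measure.bind_apply hB M.kernel.measurable.aemeasurable

/-- `r̄(ν, φ) = ∫∫ r(s, u) φ(du | s) ν(ds)`. -/
theorem liftReward_eq (ν : ProbabilityMeasure S) (φ : DecisionRule M)
    (h : Integrable M.reward (pairLaw M ν φ)) :
    liftReward M ν φ =
      ∫ s, ∫ u, Function.extend Pairs.toProd M.reward 0 (s, u) ∂(φ.1 s) ∂(ν : Measure S) := by
  have e := measurableEmbedding_toProd M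
  have hr : ∀ᵐ p ∂(jointLaw M ν φ : Measure (S × U)),
      p ∈ Set.range (Pairs.toProd : M.K → S × U) := by
    filter_upwards [ae_feasible M ν φ] with p hp using ⟨⟨p, hp⟩, rfl⟩
  have h2 : (pairLaw M ν φ).map Pairs.toProd = (jointLaw M ν φ : Measure (S × U)) := by
    unfold pairLaw
    rw [e.map_comap, Measure.restrict_eq_self_of_ae_mem hr]
  have hx : (Function.extend (Pairs.toProd : M.K → S × U) M.reward 0) ∘ Pairs.toProd
      = M.reward := funext fun k => e.injective.extend_apply M.reward 0 k
  have hi : Integrable (Function.extend (Pairs.toProd : M.K → S × U) M.reward 0)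
      ((ν : Measure S) ⊗ₘ φ.1) := by
    change Integrable _ (jointLaw M ν φ : Measure (S × U))
    rw [← h2, e.integrable_map_iff, hx]
    exact h
  rw [← Measure.integral_compProd hi]
  change _ = ∫ p, _ ∂(jointLaw M ν φ : Measure (S × U))
  rw [← h2, e.integral_map]
  exact integral_congr_ae (Filter.Eventually.of_forall fun k =>
    (e.injective.extend_apply M.reward 0 k).symm)

/-- On probability measures, evaluations at measurable sets are Borel for the weak topology. -/
theorem measurable_toMeasure_borel {Z : Type*} [TopologicalSpace Z] [MetrizableSpace Z]
    [MeasurableSpace Z] [BorelSpace Z] :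
    Measurable[borel (ProbabilityMeasure Z)]
      (fun γ : ProbabilityMeasure Z => (γ : Measure Z)) := by
  let _ : MeasurableSpace (ProbabilityMeasure Z) := borel _
  have : BorelSpace (ProbabilityMeasure Z) := ⟨rfl⟩
  refine Measurable.measure_of_isPiSystem_of_isProbabilityMeasure
    (S := {s : Set Z | IsClosed s}) ?_ isPiSystem_isClosed ?_
  · rw [BorelSpace.measurable_eq (α := Z), borel_eq_generateFrom_isClosed]
  · intro F hF
    refine ENNReal.measurable_of_tendsto
      (f := fun n (γ : ProbabilityMeasure Z) => ∫⁻ z, hF.apprSeq n z ∂(γ : Measure Z)) ?_ ?_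
    · intro n
      have h : Continuous fun γ : ProbabilityMeasure Z =>
          ((γ.toFiniteMeasure.testAgainstNN (hF.apprSeq n) : NNReal) : ℝ≥0∞) :=
        ENNReal.continuous_coe.comp
          (ProbabilityMeasure.continuous_testAgainstNN_eval (hF.apprSeq n))
      simpa using h.measurable
    · rw [tendsto_pi_nhds]
      intro γ
      exact HasOuterApproxClosed.tendsto_lintegral_apprSeq hF (γ : Measure Z)

section Measurized

variable (feas : ProbabilityMeasure S → Set (DecisionRule M))

theorem measurable_pairLaw :
    Measurable (fun k : Pairs (liftTopology M) feas => pairLaw M k.1.1 k.1.2) := by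
  have hc : Continuous (fun k : Pairs (liftTopology M) feas => jointLaw M k.1.1 k.1.2) := by
    let _ := liftTopology M
    have h1 : Continuous (fun p : ProbabilityMeasure S × DecisionRule M => jointLaw M p.1 p.2) :=
      continuous_induced_dom
    exact h1.comp continuous_subtype_val
  have hm : Measurable (fun k : Pairs (liftTopology M) feas =>
      (jointLaw M k.1.1 k.1.2 : Measure (S × U))) := by
    let _ : MeasurableSpace (ProbabilityMeasure (S × U)) := borel _
    have : BorelSpace (ProbabilityMeasure (S × U)) := ⟨rfl⟩
    exact measurable_toMeasure_borel.comp hc.measurable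
  refine Measure.measurable_of_measurable_coe _ fun B hB => ?_
  have e := measurableEmbedding_toProd M
  simp only [pairLaw, e.comap_apply]
  exact (Measure.measurable_coe (e.measurableSet_image.2 hB)).comp hm

/-- The measurized model with feasible sets `Φ(ν) = feas ν`: the states are the probability measures
`ν` on `S`, the actions are the decision rules `φ`, the next state is `F(ν, φ)` with certainty, and
the reward is the expected reward `∫∫ r(s, u) φ(du | s) ν(ds)`. As in every decision model, the
sets `Φ(ν)` are nonempty and the set of feasible pairs `(ν, φ)` is Borel. -/
def measurized (hne : ∀ ν, (feas ν).Nonempty)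
    (hmeas : MeasurableSet[@borel _ (liftTopology M)]
      {p : ProbabilityMeasure S × DecisionRule M | p.2 ∈ feas p.1}) :
    DecisionModel (ProbabilityMeasure S) (DecisionRule M) (liftTopology M) where
  feasible := feas
  feasible_nonempty := hne
  measurableSet_pairs := hmeas
  kernel := Kernel.deterministic (fun k => transition M k.1.1 k.1.2)
    (((Measure.measurable_bind' M.kernel.measurable).comp
      (measurable_pairLaw M feas)).subtype_mk)
  isMarkovKernel := Kernel.isMarkovKernel_deterministic _
  reward := fun k => liftReward M k.1.1 k.1.2
  measurable_reward := by
    let κ : Kernel (Pairs (liftTopology M) feas) M.K :=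
      ⟨fun k => pairLaw M k.1.1 k.1.2, measurable_pairLaw M feas⟩
    exact (StronglyMeasurable.integral_kernel (κ := κ)
      M.measurable_reward.stronglyMeasurable).measurable

end Measurized

end StandardModel
end Lift
end MarkovDecision

/-! Everything is transported to joint laws. The topology at `ν` is pulled back along `φ ↦ jointLaw
M ν φ`, and by disintegration the image of this map is the set of all laws on `S × U` that have
first marginal `ν` and live on the feasible pairs (`exists_jointLaw_eq`). Since `ν` is tight and the
feasible pairs over a compact set are compact, this image is compact (`isCompact_setOf_map_fst_eq`).
So the decision rules form a compact space at every `ν`, and sup-compactness only needs closed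
superlevel sets.

The lifted reward is the integral of a bounded u.s.c. function, hence u.s.c. in the joint law
(`upperSemicontinuous_integral`). The next state depends continuously on the joint law because the
kernel is Feller (`continuous_bind`), and integrating `g` against a Dirac mass is evaluation.

Bounded discounted rewards give every policy a finite value, so the remaining difficulty is that a
policy exists at all: a rule in `feas ν` must be chosen with a joint law measurable in `ν`. The
joint laws of feasible pairs form a Borel set with compact sections, and such sets have Borel
selections. This rests on the chain Novikov separation, Kunugui–Novikov, Borel projections along
compact sections, and successive minimization of coordinates
(`exists_measurable_selection_of_isClosed_sections`). -/

namespace MeasureTheory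

/-! ### Joint separation of countably many analytic sets. -/

section Novikov

variable {α : Type*} [MeasurableSpace α]

/-- A sequence of sets is jointly separable if its members are contained in measurable sets with
empty intersection. -/
def JointlySeparable (s : ℕ → Set α) : Prop :=
  ∃ u : ℕ → Set α, (∀ n, s n ⊆ u n) ∧ (∀ n, MeasurableSet (u n)) ∧ ⋂ n, u n = ∅

/-- Take unions over `k` at the index `i` and intersections elsewhere: a common point lies in some
`u k i`, hence in `u k n` for every `n`. Used contrapositively: when the `i`-th set is split,
non-separability survives in one of the pieces. -/
theorem JointlySeparable.of_subset_iUnion {s : ℕ → Set α} {t : ℕ → ℕ → Set α} (i : ℕ)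
    (h : ∀ k, JointlySeparable (t k)) (hi : s i ⊆ ⋃ k, t k i)
    (hn : ∀ k n, n ≠ i → s n ⊆ t k n) : JointlySeparable s := by
  classical
  choose u hu hm he using h
  refine ⟨fun n => if n = i then ⋃ k, u k i else ⋂ k, u k n, fun n => ?_, fun n => ?_, ?_⟩
  · by_cases h : n = i
    · subst h
      simpa using hi.trans (Set.iUnion_mono fun k => hu k n)
    · simpa [h] using fun k => (hn k n h).trans (hu k n)
  · by_cases h : n = i
    · simpa [h] using MeasurableSet.iUnion fun k => hm k i
    · simpa [h] using MeasurableSet.iInter fun k => hm k n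
  · refine Set.eq_empty_of_forall_notMem fun x hx => ?_
    rw [Set.mem_iInter] at hx
    obtain ⟨k, hk⟩ : ∃ k, x ∈ u k i := by simpa using hx i
    have : x ∈ ⋂ n, u k n := by
      refine Set.mem_iInter.2 fun n => ?_
      by_cases h : n = i
      · exact h ▸ hk
      · have := hx n
        simp only [h, if_false, Set.mem_iInter] at this
        exact this k
    simp [he k] at this

theorem JointlySeparable.of_disjoint {u v : Set α} {t : ℕ → Set α} {i j : ℕ} (hij : i ≠ j)
    (hu : MeasurableSet u) (hv : MeasurableSet v) (huv : Disjoint u v) (hi : t i ⊆ u)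
    (hj : t j ⊆ v) : JointlySeparable t := by
  classical
  refine ⟨fun n => if n = i then u else if n = j then v else Set.univ, fun n => ?_, fun n => ?_, ?_⟩
  · dsimp only
    split_ifs with h1 h2
    · exact h1 ▸ hi
    · exact h2 ▸ hj
    · exact Set.subset_univ _
  · dsimp only
    split_ifs <;> simp [hu, hv]
  · refine Set.eq_empty_of_forall_notMem fun x hx => ?_
    rw [Set.mem_iInter] at hx
    have h1 := hx i
    have h2 := hx j
    simp only [if_true, hij.symm, if_false] at h1 h2
    exact Set.disjoint_left.1 huv h1 h2

open PiNat in
/-- A tree argument: a property of cylinders of `ℕ → ℕ` that holds at the root and that passes from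
each cylinder to one of its children holds along a branch. -/
theorem exists_branch {P : ℕ → Set (ℕ → ℕ) → Prop} (h0 : P 0 Set.univ)
    (hs : ∀ n x, P n (PiNat.cylinder x n) → ∃ k, P (n + 1) (PiNat.cylinder (Function.update x n k) (n + 1))) :
    ∃ x : ℕ → ℕ, ∀ n, P n (PiNat.cylinder x n) := by
  let A := {p : ℕ × (ℕ → ℕ) // P p.1 (PiNat.cylinder p.2 p.1)}
  have : ∀ p : A, ∃ q : A, q.1.1 = p.1.1 + 1 ∧ q.1.2 ∈ PiNat.cylinder p.1.2 p.1.1 := by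
    rintro ⟨⟨n, x⟩, hp⟩
    obtain ⟨k, hk⟩ := hs n x hp
    exact ⟨⟨⟨n + 1, Function.update x n k⟩, hk⟩, rfl, update_mem_cylinder _ _ _⟩
  choose F hFn hFx using this
  let p : ℕ → A := fun n => F^[n] ⟨⟨0, fun _ => 0⟩, by simpa using h0⟩
  have prec : ∀ n, p (n + 1) = F (p n) := fun n => by
    simp only [p, Function.iterate_succ', Function.comp]
  have pn_fst : ∀ n, (p n).1.1 = n := fun n => by
    induction n with
    | zero => rfl
    | succ n IH => simp only [prec, hFn, IH]
  have Ix : ∀ m n, m + 1 ≤ n → (p n).1.2 m = (p (m + 1)).1.2 m := by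
    intro m
    apply Nat.le_induction
    · rfl
    intro n hmn IH
    have I : (F (p n)).val.2 m = (p n).val.2 m := by
      apply hFx (p n) m
      rw [pn_fst]
      exact hmn
    rw [prec, I, IH]
  -- Stage `n` only fixes the coordinates below `n`, so coordinate `n` is read off at stage `n + 1`.
  refine ⟨fun n => (p (n + 1)).1.2 n, fun n => ?_⟩
  have h := (p n).2
  rw [pn_fst] at h
  convert! h using 1
  rw [← mem_cylinder_iff_eq, mem_cylinder_iff]
  exact fun i hi => (Ix i n hi).symm

open PiNat in
/-- The **Novikov separation theorem**: if countably many analytic sets have empty intersection, then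
they are contained in measurable sets with empty intersection. -/
theorem AnalyticSet.jointlySeparable [TopologicalSpace α] [T2Space α] [OpensMeasurableSpace α]
    {s : ℕ → Set α} (hs : ∀ n, AnalyticSet (s n)) (h : ⋂ n, s n = ∅) : JointlySeparable s := by
  classical
  by_cases hne : ∃ n, s n = ∅
  · obtain ⟨n, hn⟩ := hne
    exact JointlySeparable.of_disjoint (n.lt_succ_self.ne) MeasurableSet.empty
      MeasurableSet.univ (Set.empty_disjoint _) hn.subset (Set.subset_univ _)
  push Not at hne
  have hf : ∀ n, ∃ f : (ℕ → ℕ) → α, Continuous f ∧ Set.range f = s n := fun n => by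
    have := hs n
    rw [AnalyticSet] at this
    exact this.resolve_left (hne n).ne_empty
  choose f hf hfs using hf
  -- One point `w` parametrizes all the sets at once, and coordinate `m` of `w` is read only by the
  -- set of index `(Nat.unpair m).1`. Refining a cylinder at `m` thus splits one image and leaves
  -- the others alone.
  let F : ℕ → (ℕ → ℕ) → α := fun n w => f n fun j => w (Nat.pair n j)
  have hF : ∀ n, Continuous (F n) := fun n => (hf n).comp (by fun_prop)
  have hFs : ∀ n, Set.range (F n) = s n := by
    intro n
    rw [← hfs n]
    refine Set.Subset.antisymm (Set.range_subset_iff.2 fun w => ⟨_, rfl⟩)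
      (Set.range_subset_iff.2 fun x => ⟨fun k => x (Nat.unpair k).2, ?_⟩)
    simp [F]
  by_contra hsep
  obtain ⟨w, hw⟩ := exists_branch (P := fun _ C => ¬ JointlySeparable fun n => F n '' C)
    (by simpa [hFs] using hsep) (by
      intro m x
      contrapose!
      intro H
      refine JointlySeparable.of_subset_iUnion (Nat.unpair m).1 H ?_ ?_
      · rw [← Set.image_iUnion]
        exact Set.image_mono (iUnion_cylinder_update (E := fun _ => ℕ) x m).ge
      · rintro k n hn - ⟨y, hy, rfl⟩
        refine ⟨Function.update y m k, ?_, ?_⟩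
        · rw [mem_cylinder_iff] at hy ⊢
          intro i hi
          rcases Nat.lt_succ_iff_lt_or_eq.1 hi with h | rfl
          · simp [h.ne, hy i h]
          · simp
        · refine congrArg (f n) (funext fun j => Function.update_of_ne ?_ _ _)
          rintro rfl
          simp at hn)
  -- Equal values would give a common point. Two different values have disjoint open neighbourhoods,
  -- which separate the images of a small enough cylinder around `w`.
  obtain ⟨i, j, hij⟩ : ∃ i j, F i w ≠ F j w := by
    by_contra! H
    have : F 0 w ∈ ⋂ n, s n :=
      Set.mem_iInter.2 fun n => by rw [H 0 n, ← hFs n]; exact ⟨w, rfl⟩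
    simp [h] at this
  obtain ⟨u, v, hu, hv, hxu, hyv, huv⟩ := t2_separation hij
  let _ : MetricSpace (ℕ → ℕ) := metricSpaceNatNat
  have hnhds : (F i) ⁻¹' u ∩ (F j) ⁻¹' v ∈ 𝓝 w :=
    Filter.inter_mem ((hF i).continuousAt.preimage_mem_nhds (hu.mem_nhds hxu))
      ((hF j).continuousAt.preimage_mem_nhds (hv.mem_nhds hyv))
  obtain ⟨ε, hε, hb⟩ := Metric.mem_nhds_iff.1 hnhds
  obtain ⟨n, hn⟩ := exists_pow_lt_of_lt_one hε (show (1 / 2 : ℝ) < 1 by norm_num)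
  have hc : PiNat.cylinder w n ⊆ (F i) ⁻¹' u ∩ (F j) ⁻¹' v := fun z hz =>
    hb ((mem_cylinder_iff_dist_le.1 hz).trans_lt hn)
  exact hw n (JointlySeparable.of_disjoint (fun e : i = j => hij (by rw [e])) hu.measurableSet
    hv.measurableSet huv (Set.image_subset_iff.2 fun z hz => (hc hz).1)
    (Set.image_subset_iff.2 fun z hz => (hc hz).2))

end Novikov

/-! ### Borel sets with open or closed sections: structure, projection, selection. -/

section Sections

variable {X Y : Type*} [MeasurableSpace X] [StandardBorelSpace X]
  [TopologicalSpace Y] [PolishSpace Y] [MeasurableSpace Y] [BorelSpace Y]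

/-- The **Kunugui–Novikov theorem**: a measurable set with open sections is a countable union of
products of measurable sets with open sets. -/
theorem exists_eq_iUnion_prod_of_isOpen_sections {A : Set (X × Y)} (hA : MeasurableSet A)
    (ho : ∀ x, IsOpen {y | (x, y) ∈ A}) :
    ∃ (B : ℕ → Set X) (V : ℕ → Set Y), (∀ n, MeasurableSet (B n)) ∧ (∀ n, IsOpen (V n)) ∧
      A = ⋃ n, B n ×ˢ V n := by
  let _ := upgradeStandardBorel X
  -- The empty set is added so that the family is nonempty and can be enumerated.
  obtain ⟨V, hV⟩ := ((countable_countableBasis Y).insert ∅).exists_eq_range (Set.insert_nonempty _ _)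
  have hVo : ∀ n, IsOpen (V n) := fun n => by
    have : V n ∈ insert ∅ (countableBasis Y) := hV ▸ ⟨n, rfl⟩
    rcases this with h | h
    · exact h ▸ isOpen_empty
    · exact isOpen_of_mem_countableBasis h
  have hVb : ∀ (O : Set Y) (y : Y), IsOpen O → y ∈ O → ∃ n, y ∈ V n ∧ V n ⊆ O := fun O y hO hy => by
    obtain ⟨v, hv, hyv, hvO⟩ := (isBasis_countableBasis Y).exists_subset_of_mem_open hy hO
    obtain ⟨n, rfl⟩ : v ∈ Set.range V := hV ▸ Set.mem_insert_of_mem _ hv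
    exact ⟨n, hyv, hvO⟩
  have hVm : ∀ n, MeasurableSet (V n) := fun n => (hVo n).measurableSet
  -- The points `x` for which `V n` is not contained in the section of `A`.
  let E : ℕ → Set X := fun n => Prod.fst '' (Aᶜ ∩ Prod.snd ⁻¹' V n)
  have hE : ∀ n, AnalyticSet (E n) := fun n =>
    (hA.compl.inter (measurable_snd (hVm n))).analyticSet_image measurable_fst
  -- The projection of `T n` consists of the points of `A` that `V n` does not serve: it misses the
  -- point or leaves the section. Open sections mean that every point of `A` is served by some `n`,
  -- so these analytic sets have empty intersection.
  let T : ℕ → Set ((X × Y) × Y) := fun n =>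
    {p | p.1 ∈ A ∧ (p.1.2 ∉ V n ∨ (p.2 ∈ V n ∧ (p.1.1, p.2) ∉ A))}
  have hT : ∀ n, MeasurableSet (T n) := fun n => by
    refine (measurable_fst hA).inter (MeasurableSet.union ?_ (MeasurableSet.inter ?_ ?_))
    · exact ((measurable_snd.comp measurable_fst) (hVm n)).compl
    · exact measurable_snd (hVm n)
    · exact (((measurable_fst.comp measurable_fst).prodMk measurable_snd) hA).compl
  have hs : ∀ n, AnalyticSet (Prod.fst '' T n) := fun n =>
    (hT n).analyticSet_image measurable_fst
  obtain ⟨C, hC, hCm, hCe⟩ := AnalyticSet.jointlySeparable hs (by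
    refine Set.eq_empty_of_forall_notMem fun p hp => ?_
    rw [Set.mem_iInter] at hp
    obtain ⟨⟨q, y'⟩, hq, rfl⟩ := hp 0
    obtain ⟨n, hyn, hn⟩ := hVb _ q.2 (ho q.1) hq.1
    obtain ⟨⟨q', y''⟩, hq', rfl⟩ := hp n
    rcases hq'.2 with h | h
    · exact h hyn
    · exact h.2 (hn h.1))
  have hD : ∀ n, ∀ p ∈ A \ C n, p.2 ∈ V n ∧ p.1 ∉ E n := by
    rintro n p ⟨hpA, hpC⟩
    refine ⟨by_contra fun h => hpC (hC n ⟨(p, p.2), ⟨hpA, Or.inl h⟩, rfl⟩), ?_⟩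
    rintro ⟨q, ⟨hqA, hqV⟩, hq⟩
    exact hpC (hC n ⟨(p, q.2), ⟨hpA, Or.inr ⟨hqV, by rwa [← hq]⟩⟩, rfl⟩)
  -- Lusin separation in `X`: a Borel `B n` that avoids `E n` keeps `B n ×ˢ V n` inside `A`, and the
  -- sets `A \ C n` cover `A`.
  have hB : ∀ n, MeasurablySeparable (Prod.fst '' (A \ C n)) (E n) := fun n =>
    ((hA.diff (hCm n)).analyticSet_image measurable_fst).measurablySeparable (hE n) (by
      rw [Set.disjoint_left]
      rintro - ⟨p, hp, rfl⟩ hpE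
      exact (hD n p hp).2 hpE)
  choose B hBs hBd hBm using hB
  refine ⟨B, V, hBm, hVo, Set.Subset.antisymm (fun p hp => ?_) (Set.iUnion_subset fun n p hp => ?_)⟩
  · have : p ∉ ⋂ n, C n := by simp [hCe]
    simp only [Set.mem_iInter, not_forall] at this
    obtain ⟨n, hn⟩ := this
    exact Set.mem_iUnion.2 ⟨n, hBs n ⟨p, ⟨hp, hn⟩, rfl⟩, (hD n p ⟨hp, hn⟩).1⟩
  · by_contra h
    exact Set.disjoint_left.1 (hBd n) ⟨p, ⟨h, hp.2⟩, rfl⟩ hp.1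

/-- The projection of a measurable set along a compact space is measurable if the sections are
closed. -/
theorem measurableSet_image_fst_of_isClosed_sections [CompactSpace Y] {C : Set (X × Y)}
    (hC : MeasurableSet C) (hc : ∀ x, IsClosed {y | (x, y) ∈ C}) :
    MeasurableSet (Prod.fst '' C) := by
  obtain ⟨B, V, hB, hV, hBV⟩ := exists_eq_iUnion_prod_of_isOpen_sections hC.compl
    fun x => (hc x).isOpen_compl
  -- A point is off the projection when its section of `Cᶜ` is all of `Y`. By compactness finitely
  -- many `V n` then suffice, and whether they cover `Y` does not depend on the point.
  have h : (Prod.fst '' C)ᶜ =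
      ⋃ (J : Finset ℕ) (_ : Set.univ ⊆ ⋃ n ∈ J, V n), ⋂ n ∈ J, B n := by
    ext x
    simp only [Set.mem_compl_iff, Set.mem_iUnion, Set.mem_iInter]
    constructor
    · intro hx
      have hcov : Set.univ ⊆ ⋃ n : {n // x ∈ B n}, V n := fun y _ => by
        have hy : (x, y) ∈ Cᶜ := fun h => hx ⟨_, h, rfl⟩
        rw [hBV] at hy
        obtain ⟨n, hn⟩ := Set.mem_iUnion.1 hy
        exact Set.mem_iUnion.2 ⟨⟨n, hn.1⟩, hn.2⟩
      obtain ⟨J, hJ⟩ := isCompact_univ.elim_finite_subcover _ (fun n => hV _) hcov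
      refine ⟨J.map (Function.Embedding.subtype _), fun y hy => ?_, fun n hn => ?_⟩
      · obtain ⟨n, hn, hyn⟩ := Set.mem_iUnion₂.1 (hJ hy)
        exact Set.mem_iUnion₂.2 ⟨n, Finset.mem_map_of_mem _ hn, hyn⟩
      · obtain ⟨m, -, rfl⟩ := Finset.mem_map.1 hn
        exact m.2
    · rintro ⟨J, hJ, hx⟩ ⟨p, hp, rfl⟩
      obtain ⟨n, hn, hyn⟩ := Set.mem_iUnion₂.1 (hJ (Set.mem_univ p.2))
      have : p ∈ Cᶜ := hBV ▸ Set.mem_iUnion.2 ⟨n, hx n hn, hyn⟩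
      exact this hp
  rw [← MeasurableSet.compl_iff, h]
  exact MeasurableSet.iUnion fun J => MeasurableSet.iUnion fun _ =>
    Finset.measurableSet_biInter _ fun n _ => hB n

/-- The minimum of a continuous function over the sections of a measurable set with nonempty closed
sections in a compact space is measurable. -/
theorem measurable_sInf_image_of_isClosed_sections [CompactSpace Y] {C : Set (X × Y)}
    (hC : MeasurableSet C) (hc : ∀ x, IsClosed {y | (x, y) ∈ C})
    (hne : ∀ x, {y | (x, y) ∈ C}.Nonempty) {g : Y → ℝ} (hg : Continuous g) :
    Measurable fun x => sInf (g '' {y | (x, y) ∈ C}) := by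
  refine measurable_of_Iic fun c => ?_
  have h : (fun x => sInf (g '' {y | (x, y) ∈ C})) ⁻¹' Set.Iic c =
      Prod.fst '' (C ∩ {p | g p.2 ≤ c}) := by
    ext x
    have hcomp : IsCompact (g '' {y | (x, y) ∈ C}) := (hc x).isCompact.image hg
    constructor
    · intro hx
      obtain ⟨y, hy, hy'⟩ := hcomp.sInf_mem ((hne x).image g)
      exact ⟨(x, y), ⟨hy, (hy'.trans_le hx : _)⟩, rfl⟩
    · rintro ⟨p, ⟨hp, hpc⟩, rfl⟩
      exact (csInf_le hcomp.bddBelow ⟨p.2, hp, rfl⟩).trans hpc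
  rw [h]
  refine measurableSet_image_fst_of_isClosed_sections (hC.inter ?_) fun x => ?_
  · exact measurableSet_le (hg.measurable.comp measurable_snd) measurable_const
  · exact (hc x).inter (isClosed_le hg continuous_const)

/-- A measurable set with nonempty closed sections in a compact metrizable space has a measurable
selection. -/
theorem exists_measurable_selection_of_isClosed_sections [CompactSpace Y] {C : Set (X × Y)}
    (hC : MeasurableSet C) (hc : ∀ x, IsClosed {y | (x, y) ∈ C})
    (hne : ∀ x, {y | (x, y) ∈ C}.Nonempty) :
    ∃ f : X → Y, Measurable f ∧ ∀ x, (x, f x) ∈ C := by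
  let _ := upgradeIsCompletelyMetrizable Y
  obtain ⟨G, hG⟩ := Metric.PiNatEmbed.exists_embedding_to_hilbert_cube (X := Y)
  let g : ℕ → Y → ℝ := fun k y => G y k
  have hg : ∀ k, Continuous (g k) := fun k =>
    continuous_subtype_val.comp ((continuous_apply k).comp hG.continuous)
  let m : Set (X × Y) → ℕ → X → ℝ := fun D k x => sInf (g k '' {y | (x, y) ∈ D})
  -- Lexicographic minimization: `D (k + 1)` keeps the points of each section of `D k` where the
  -- coordinate `g k` is minimal. The sections stay nonempty and compact, so they have a common
  -- point, all of whose coordinates are measurable minima.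
  let D : ℕ → Set (X × Y) := fun n =>
    Nat.rec C (fun k D => D ∩ {p | g k p.2 = m D k p.1}) n
  have hDs : ∀ k, D (k + 1) = D k ∩ {p | g k p.2 = m (D k) k p.1} := fun k => rfl
  have hD : ∀ n, MeasurableSet (D n) ∧ (∀ x, IsClosed {y | (x, y) ∈ D n}) ∧
      ∀ x, {y | (x, y) ∈ D n}.Nonempty := by
    intro n
    induction n with
    | zero => exact ⟨hC, hc, hne⟩
    | succ k ih =>
      obtain ⟨h1, h2, h3⟩ := ih
      have hm := measurable_sInf_image_of_isClosed_sections h1 h2 h3 (hg k)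
      rw [hDs]
      refine ⟨h1.inter (measurableSet_eq_fun ((hg k).measurable.comp measurable_snd)
        (hm.comp measurable_fst)), fun x => (h2 x).inter 
        (isClosed_eq (hg k) (continuous_const (y := m (D k) k x))),
        fun x => ?_⟩
      obtain ⟨y, hy, hy'⟩ := ((h2 x).isCompact.image (hg k)).sInf_mem ((h3 x).image _)
      exact ⟨y, hy, hy'⟩
  have hf : ∀ x, ∃ y, ∀ n, (x, y) ∈ D n := fun x => by
    obtain ⟨y, hy⟩ := IsCompact.nonempty_iInter_of_sequence_nonempty_isCompact_isClosed
      (fun n => {y | (x, y) ∈ D n}) (fun n y hy => hy.1) (fun n => (hD n).2.2 x)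
      ((hD 0).2.1 x).isCompact (fun n => (hD n).2.1 x)
    exact ⟨y, fun n => Set.mem_iInter.1 hy n⟩
  choose f hf using hf
  refine ⟨f, ?_, fun x => hf x 0⟩
  rw [← (hG.continuous.measurableEmbedding hG.injective).measurable_comp_iff]
  refine measurable_pi_lambda _ fun k => Measurable.subtype_mk (f := fun x => g k (f x)) ?_
  have : (fun x => g k (f x)) = m (D k) k := funext fun x => (hf x (k + 1)).2
  rw [this]
  exact measurable_sInf_image_of_isClosed_sections (hD k).1 (hD k).2.1 (hD k).2.2 (hg k)

end Sections

end MeasureTheory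

/-! ### Topology and Borel structure of the space of probability measures. -/

namespace MeasureTheory.ProbabilityMeasure

section Inducing

variable {Z W : Type*} [TopologicalSpace Z] [MeasurableSpace Z] [BorelSpace Z]
  [TopologicalSpace W] [PseudoMetrizableSpace W] [SecondCountableTopology W] [MeasurableSpace W]
  [BorelSpace W] {f : Z → W}

/-- The push-forward of probability measures along an inducing map is inducing. -/
theorem isInducing_map (hf : IsInducing f) :
    IsInducing fun μ : ProbabilityMeasure Z => μ.map hf.continuous.measurable.aemeasurable := by
  refine isInducing_iff_nhds.2 fun μ =>
    le_antisymm ((continuous_map hf.continuous).tendsto μ).le_comap ?_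
  have : Filter.Tendsto id (Filter.comap (fun μ : ProbabilityMeasure Z =>
      μ.map hf.continuous.measurable.aemeasurable)
      (𝓝 (μ.map hf.continuous.measurable.aemeasurable))) (𝓝 μ) := by
    -- Portmanteau: open sets test convergence, and those of `Z` are preimages of open sets of `W`.
    refine tendsto_of_forall_isOpen_le_liminf' fun G hG => ?_
    obtain ⟨O, hO, rfl⟩ := hf.isOpen_iff.1 hG
    have h := le_liminf_measure_open_of_tendsto
      (Filter.tendsto_comap (f := fun μ : ProbabilityMeasure Z =>
        μ.map hf.continuous.measurable.aemeasurable)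
      (x := 𝓝 (μ.map hf.continuous.measurable.aemeasurable))) hO
    simp only [map_apply' _ _ hO.measurableSet] at h
    exact h
  exact this

theorem isEmbedding_map [PseudoMetrizableSpace Z] (hf : IsEmbedding f) :
    IsEmbedding fun μ : ProbabilityMeasure Z => μ.map hf.continuous.measurable.aemeasurable := by
  have : T0Space (ProbabilityMeasure Z) := inferInstance
  exact (isInducing_map hf.isInducing).isEmbedding

end Inducing

/-- The index type may be uncountable; second countability makes any subbasis generate the Borel
σ-algebra. -/
theorem _root_.TopologicalSpace.borel_le_of_eq_iInf_induced {X ι : Type*} {Y : ι → Type*}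
    [t : TopologicalSpace X] [SecondCountableTopology X] [m : MeasurableSpace X]
    [∀ i, TopologicalSpace (Y i)] [∀ i, MeasurableSpace (Y i)] [∀ i, OpensMeasurableSpace (Y i)]
    {f : ∀ i, X → Y i} (ht : t = ⨅ i, TopologicalSpace.induced (f i) inferInstance)
    (hf : ∀ i, Measurable (f i)) : borel X ≤ m := by
  rw [← generateFrom_iUnion_isOpen] at ht
  rw [borel_eq_generateFrom_of_subbasis ht]
  refine MeasurableSpace.generateFrom_le fun s hs => ?_
  obtain ⟨i, O, hO, rfl⟩ := Set.mem_iUnion.1 hs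
  exact hf i hO.measurableSet

theorem _root_.TopologicalSpace.exists_isEmbedding_hilbertCube (Z : Type*) [TopologicalSpace Z]
    [MetrizableSpace Z] [SecondCountableTopology Z] :
    ∃ f : Z → ℕ → unitInterval, IsEmbedding f := by
  let _ := metrizableSpaceMetric Z
  exact Metric.PiNatEmbed.exists_embedding_to_hilbert_cube

theorem eq_iInf_induced_testAgainstNN {Z : Type*} [TopologicalSpace Z] [MeasurableSpace Z]
    [OpensMeasurableSpace Z] :
    (inferInstance : TopologicalSpace (ProbabilityMeasure Z)) =
      ⨅ f : BoundedContinuousFunction Z NNReal, TopologicalSpace.induced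
        (fun μ : ProbabilityMeasure Z => μ.toFiniteMeasure.testAgainstNN f) inferInstance := by
  refine le_antisymm (le_iInf fun f => (continuous_testAgainstNN_eval f).le_induced) ?_
  refine le_of_nhds_le_nhds fun μ => ?_
  have h : Filter.Tendsto (id : ProbabilityMeasure Z → ProbabilityMeasure Z)
      (⨅ f : BoundedContinuousFunction Z NNReal, Filter.comap
        (fun μ : ProbabilityMeasure Z => μ.toFiniteMeasure.testAgainstNN f)
        (𝓝 (μ.toFiniteMeasure.testAgainstNN f))) (𝓝 μ) := by
    rw [tendsto_nhds_iff_toFiniteMeasure_tendsto_nhds,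
      FiniteMeasure.tendsto_iff_forall_testAgainstNN_tendsto]
    exact fun f => Filter.tendsto_iInf' f Filter.tendsto_comap
  simpa [nhds_iInf, nhds_induced, Filter.Tendsto] using h

theorem _root_.MeasurableEquiv.standardBorelSpace {A B : Type*} [MeasurableSpace A]
    [MeasurableSpace B] [StandardBorelSpace A] (e : A ≃ᵐ B) : StandardBorelSpace B := by
  let _ := upgradeStandardBorel A
  let _ : TopologicalSpace B := TopologicalSpace.induced e.symm inferInstance
  have : PolishSpace B :=
    (e.symm.toEquiv.toHomeomorphOfIsInducing ⟨rfl⟩).isClosedEmbedding.polishSpace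
  have : BorelSpace B := by
    refine ⟨?_⟩
    rw [borel_comap, ← BorelSpace.measurable_eq (α := A)]
    exact e.symm.measurableEmbedding.comap_eq.symm
  infer_instance

section Countability

variable {Z : Type*} [TopologicalSpace Z] [MetrizableSpace Z] [SecondCountableTopology Z]
  [MeasurableSpace Z] [BorelSpace Z]

instance [CompactSpace Z] : SecondCountableTopology (ProbabilityMeasure Z) := by
  let _ := pseudoMetrizableSpacePseudoMetric (ProbabilityMeasure Z)
  infer_instance

instance [CompactSpace Z] : PolishSpace (ProbabilityMeasure Z) := by
  let _ := metrizableSpaceMetric (ProbabilityMeasure Z)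
  infer_instance

instance : SecondCountableTopology (ProbabilityMeasure Z) := by
  obtain ⟨f, hf⟩ := exists_isEmbedding_hilbertCube Z
  exact (isEmbedding_map hf).secondCountableTopology

/-- The σ-algebra on the left is generated by evaluations at measurable sets. These are Borel;
conversely, integrals of test functions are measurable for it and induce the topology. -/
instance : BorelSpace (ProbabilityMeasure Z) := by
  refine ⟨le_antisymm ?_ ?_⟩
  · have h := MarkovDecision.StandardModel.measurable_toMeasure_borel (Z := Z)
    exact MeasurableSpace.comap_le_iff_le_map.2 h
  · refine borel_le_of_eq_iInf_induced eq_iInf_induced_testAgainstNN fun f => ?_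
    refine Measurable.ennreal_toNNReal ?_
    exact (Measure.measurable_lintegral f.measurable_coe_ennreal_comp).comp measurable_subtype_coe

/-- The range consists of the measures that do not charge the complement of `Set.range f`, which is
Borel because `Z` is standard. -/
theorem measurableEmbedding_map_of_isEmbedding [StandardBorelSpace Z] {W : Type*}
    [TopologicalSpace W] [MetrizableSpace W] [SecondCountableTopology W] [MeasurableSpace W]
    [BorelSpace W] {f : Z → W} (hf : IsEmbedding f) :
    MeasurableEmbedding
      fun μ : ProbabilityMeasure Z => μ.map hf.continuous.measurable.aemeasurable := by
  have hm : MeasurableEmbedding f := hf.continuous.measurable.measurableEmbedding hf.injective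
  refine (isEmbedding_map hf).measurableEmbedding ?_
  have h : Set.range (fun μ : ProbabilityMeasure Z =>
      μ.map hf.continuous.measurable.aemeasurable) =
      {μ : ProbabilityMeasure W | (μ : Measure W) (Set.range f)ᶜ = 0} := by
    ext μ
    constructor
    · rintro ⟨ν, rfl⟩
      change (ν.map hf.continuous.measurable.aemeasurable : Measure W) _ = 0
      rw [map_apply' _ _ hm.measurableSet_range.compl]
      simp
    · intro h
      have h' : ∀ᵐ w ∂(μ : Measure W), w ∈ Set.range f := h
      refine ⟨⟨(μ : Measure W).comap f, hm.isProbabilityMeasure_comap h'⟩, Subtype.ext ?_⟩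
      change ((μ : Measure W).comap f).map f = μ
      rw [hm.map_comap, Measure.restrict_eq_self_of_ae_mem h']
  rw [h]
  exact (Measure.measurable_coe hm.measurableSet_range.compl).comp measurable_subtype_coe
    (measurableSet_singleton 0)

instance [StandardBorelSpace Z] : StandardBorelSpace (ProbabilityMeasure Z) := by
  obtain ⟨f, hf⟩ := exists_isEmbedding_hilbertCube Z
  have hm := measurableEmbedding_map_of_isEmbedding hf
  have : StandardBorelSpace (Set.range fun μ : ProbabilityMeasure Z =>
      μ.map hf.continuous.measurable.aemeasurable) := hm.measurableSet_range.standardBorel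
  exact hm.equivRange.symm.standardBorelSpace

end Countability

end MeasureTheory.ProbabilityMeasure

/-! ### Tightness, semicontinuity of integrals, Feller kernels. -/

namespace MeasureTheory

/-- A finite measure on a metrizable space whose Borel σ-algebra is standard is tight. -/
theorem isTightMeasureSet_singleton_of_standardBorelSpace {Z : Type*} [t : TopologicalSpace Z]
    [MetrizableSpace Z] [SecondCountableTopology Z] [m : MeasurableSpace Z] [BorelSpace Z]
    [h : StandardBorelSpace Z] (μ : Measure Z) [IsFiniteMeasure μ] : IsTightMeasureSet {μ} := by
  obtain ⟨τ, hτ, hp⟩ := h.polish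
  -- The given topology need not be Polish. Refine a Polish one with the same Borel sets until the
  -- identity to the given topology is continuous; compact sets then remain compact.
  obtain ⟨τ', hle, hc, hp'⟩ := @Measurable.exists_continuous Z Z τ hp m hτ t m _ id _ measurable_id
  have hb : @BorelSpace Z τ' m := ⟨by
    rw [borel_eq_borel_of_le hp' hp hle]
    exact hτ.measurable_eq⟩
  have ht := @isTightMeasureSet_singleton Z m τ' inferInstance inferInstance hb μ _
  rw [@isTightMeasureSet_iff_exists_isCompact_measure_compl_le Z m {μ} τ'] at ht
  refine (@isTightMeasureSet_iff_exists_isCompact_measure_compl_le Z m {μ} t).2 fun ε hε => ?_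
  obtain ⟨K, hK, hKε⟩ := ht ε hε
  refine ⟨K, ?_, hKε⟩
  rw [← Set.image_id K]
  exact @IsCompact.image Z Z τ' t K id hK hc

namespace ProbabilityMeasure

/-- Layer-cake formula, Portmanteau on the open superlevel sets, then Fatou in the level. -/
theorem lintegral_le_liminf_of_lowerSemicontinuous {Z : Type*} [TopologicalSpace Z]
    [MetrizableSpace Z] [MeasurableSpace Z] [BorelSpace Z] {f : Z → ℝ} (hf : LowerSemicontinuous f)
    (h0 : 0 ≤ f) {μ : ProbabilityMeasure Z} {μs : ℕ → ProbabilityMeasure Z}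
    (h : Filter.Tendsto μs Filter.atTop (𝓝 μ)) :
    ∫⁻ z, ENNReal.ofReal (f z) ∂(μ : Measure Z) ≤
      Filter.atTop.liminf fun n => ∫⁻ z, ENNReal.ofReal (f z) ∂(μs n : Measure Z) := by
  simp_rw [lintegral_eq_lintegral_meas_lt _ (Filter.Eventually.of_forall h0)
    hf.measurable.aemeasurable]
  refine le_trans (lintegral_mono fun t =>
    le_liminf_measure_open_of_tendsto h (hf.isOpen_preimage t)) ?_
  exact lintegral_liminf_le fun n => Antitone.measurable fun s t hst =>
    measure_mono fun ω hω => lt_of_le_of_lt hst hω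

variable {Z : Type*} [TopologicalSpace Z] [MetrizableSpace Z] [SecondCountableTopology Z]
  [MeasurableSpace Z] [BorelSpace Z]

/-- The integral of a bounded upper semicontinuous function is an upper semicontinuous function of
the probability measure. -/
theorem upperSemicontinuous_integral {r : Z → ℝ} (hr : UpperSemicontinuous r)
    (ha : BddAbove (Set.range r)) (hb : BddBelow (Set.range r)) :
    UpperSemicontinuous fun μ : ProbabilityMeasure Z => ∫ z, r z ∂(μ : Measure Z) := by
  obtain ⟨b, hb'⟩ := ha
  obtain ⟨a, ha'⟩ := hb
  have hrb : ∀ z, r z ≤ b := fun z => hb' ⟨z, rfl⟩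
  have hra : ∀ z, a ≤ r z := fun z => ha' ⟨z, rfl⟩
  have hint : ∀ μ : ProbabilityMeasure Z, Integrable r (μ : Measure Z) := fun μ =>
    Integrable.of_mem_Icc a b hr.measurable.aemeasurable
      (Filter.Eventually.of_forall fun z => ⟨hra z, hrb z⟩)
  have hf : LowerSemicontinuous fun z => b - r z := by
    intro z y hy
    filter_upwards [hr z (b - y) (by dsimp only at hy; linarith)] with z' hz'
    linarith
  have hI : ∀ μ : ProbabilityMeasure Z, ∫⁻ z, ENNReal.ofReal (b - r z) ∂(μ : Measure Z) =
      ENNReal.ofReal (b - ∫ z, r z ∂(μ : Measure Z)) := fun μ => by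
    have h := ofReal_integral_eq_lintegral_ofReal (f := fun z => b - r z)
      ((integrable_const b).sub (hint μ)) (Filter.Eventually.of_forall fun z => sub_nonneg.2 (hrb z))
    rw [← h, integral_sub (integrable_const b) (hint μ)]
    simp
  intro μ y hy
  by_contra hcon
  rw [Filter.not_eventually] at hcon
  obtain ⟨μs, hμs, hy'⟩ := Filter.exists_seq_forall_of_frequently hcon
  have h := lintegral_le_liminf_of_lowerSemicontinuous hf (fun z => sub_nonneg.2 (hrb z)) hμs
  simp only [hI] at h
  have h2 : Filter.atTop.liminf (fun n => ENNReal.ofReal (b - ∫ z, r z ∂(μs n : Measure Z))) ≤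
      ENNReal.ofReal (b - y) := by
    refine Filter.liminf_le_of_frequently_le' (Filter.Frequently.of_forall fun n => ?_)
    exact ENNReal.ofReal_le_ofReal (by have := not_lt.1 (hy' n); linarith)
  -- This makes `b - y` nonnegative, so that the comparison of `ENNReal.ofReal` values can be
  -- undone.
  have hyb : y ≤ b := (not_lt.1 (hy' 0)).trans (by
    simpa using integral_mono (hint (μs 0)) (integrable_const b) hrb)
  have := (ENNReal.ofReal_le_ofReal_iff (by linarith)).1 (h.trans h2)
  dsimp only at hy
  linarith

/-- A Markov kernel with the Feller property acts continuously on probability measures. -/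
theorem continuous_bind {Z Y : Type*} [TopologicalSpace Z] [MeasurableSpace Z]
    [OpensMeasurableSpace Z] [TopologicalSpace Y] [MeasurableSpace Y] [OpensMeasurableSpace Y]
    (κ : Kernel Z Y) [IsMarkovKernel κ]
    (hκ : ∀ g : BoundedContinuousFunction Y ℝ, Continuous fun z => ∫ y, g y ∂(κ z)) :
    Continuous (X := ProbabilityMeasure Z) (Y := ProbabilityMeasure Y) fun μ =>
      (⟨κ ∘ₘ (μ : Measure Z), inferInstance⟩ : ProbabilityMeasure Y) := by
  refine continuous_iff_forall_continuous_integral.2 ?_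
  intro g
  have hb : ∀ z, ‖∫ y, g y ∂(κ z)‖ ≤ ‖g‖ := fun z => g.norm_integral_le_norm (κ z)
  let G : BoundedContinuousFunction Z ℝ :=
    BoundedContinuousFunction.ofNormedAddCommGroup (fun z => ∫ y, g y ∂(κ z)) (hκ g) ‖g‖ hb
  have h : ∀ μ : ProbabilityMeasure Z, ∫ y, g y ∂(κ ∘ₘ (μ : Measure Z)) =
      ∫ z, G z ∂(μ : Measure Z) := fun μ => by
    have h := Kernel.integral_comp (η := κ) (κ := Kernel.const Unit (μ : Measure Z)) (a := ())
      (f := g) (g.integrable _)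
    rwa [Kernel.comp_apply, Kernel.const_apply] at h
  refine Continuous.congr ?_ fun μ => (h μ).symm
  exact continuous_iff_forall_continuous_integral.1 continuous_id G

end ProbabilityMeasure

end MeasureTheory

/-! ### Joint laws: continuity, disintegration, compactness. -/

namespace MarkovDecision.StandardModel

set_option linter.unusedSectionVars false

variable {S : Type*} {U : Type*}
  [TopologicalSpace S] [MetrizableSpace S] [SecondCountableTopology S] [MeasurableSpace S]
  [BorelSpace S]
  [TopologicalSpace U] [MetrizableSpace U] [SecondCountableTopology U] [MeasurableSpace U]
  [BorelSpace U]

theorem isEmbedding_toProd {X A : Type*} [TopologicalSpace X] [TopologicalSpace A]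
    (feas : X → Set A) :
    IsEmbedding (Pairs.toProd : Pairs (instTopologicalSpaceProd : TopologicalSpace (X × A)) feas →
      X × A) :=
  ⟨⟨rfl⟩, Subtype.val_injective⟩

instance (feas : S → Set U) :
    MetrizableSpace (Pairs (instTopologicalSpaceProd : TopologicalSpace (S × U)) feas) :=
  (isEmbedding_toProd feas).metrizableSpace

instance (feas : S → Set U) :
    SecondCountableTopology (Pairs (instTopologicalSpaceProd : TopologicalSpace (S × U)) feas) :=
  (isEmbedding_toProd feas).secondCountableTopology

variable (M : StandardModel S U)

theorem measurableSet_feasiblePairs : MeasurableSet {p : S × U | p.2 ∈ M.feasible p.1} := by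
  have := M.measurableSet_pairs
  rwa [← BorelSpace.measurable_eq] at this

theorem measurableSet_feasible (s : S) : MeasurableSet (M.feasible s) :=
  (measurableSet_feasiblePairs M).preimage measurable_prodMk_left

/-- The joint law of state and action, as a probability measure on the feasible pairs. -/
def pairProbability (ν : ProbabilityMeasure S) (φ : DecisionRule M) : ProbabilityMeasure M.K :=
  ⟨pairLaw M ν φ, inferInstance⟩

theorem map_pairProbability (ν : ProbabilityMeasure S) (φ : DecisionRule M) :
    (pairProbability M ν φ).map
      (isEmbedding_toProd M.feasible).continuous.measurable.aemeasurable = jointLaw M ν φ := by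
  have e := measurableEmbedding_toProd M
  have hr : ∀ᵐ p ∂(jointLaw M ν φ : Measure (S × U)),
      p ∈ Set.range (Pairs.toProd : M.K → S × U) := by
    filter_upwards [ae_feasible M ν φ] with p hp using ⟨⟨p, hp⟩, rfl⟩
  refine Subtype.ext ?_
  change (pairLaw M ν φ).map Pairs.toProd = _
  unfold pairLaw
  rw [e.map_comap, Measure.restrict_eq_self_of_ae_mem hr]
  rfl

theorem continuous_jointLaw :
    @Continuous _ _ (liftTopology M) _
      fun p : ProbabilityMeasure S × DecisionRule M => jointLaw M p.1 p.2 :=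
  continuous_induced_dom

/-- Reward and kernel live on the feasible pairs only, while the topology is defined by laws on `S ×
U`; pushing forward along the inclusion is inducing, which bridges the two. -/
theorem continuous_pairProbability :
    @Continuous _ _ (liftTopology M) _
      fun p : ProbabilityMeasure S × DecisionRule M => pairProbability M p.1 p.2 := by
  let _ := liftTopology M
  refine (ProbabilityMeasure.isInducing_map
    (isEmbedding_toProd M.feasible).isInducing).continuous_iff.2 ?_
  exact (continuous_jointLaw M).congr fun p => (map_pairProbability M p.1 p.2).symm

theorem map_fst_jointLaw (ν : ProbabilityMeasure S) (φ : DecisionRule M) :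
    (jointLaw M ν φ).map measurable_fst.aemeasurable = ν :=
  Subtype.ext (Measure.fst_compProd (ν : Measure S) φ.1)

theorem jointLaw_compl_feasiblePairs (ν : ProbabilityMeasure S) (φ : DecisionRule M) :
    (jointLaw M ν φ : Measure (S × U)) {p | p.2 ∈ M.feasible p.1}ᶜ = 0 :=
  ae_feasible M ν φ

/-- Every law on the feasible pairs is the joint law of its first marginal and a decision rule. -/
theorem exists_jointLaw_eq [StandardBorelSpace U] (φ₀ : DecisionRule M)
    (γ : ProbabilityMeasure (S × U))
    (hγ : (γ : Measure (S × U)) {p | p.2 ∈ M.feasible p.1}ᶜ = 0) :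
    ∃ φ : DecisionRule M, jointLaw M (γ.map measurable_fst.aemeasurable) φ = γ := by
  classical
  have hK := measurableSet_feasiblePairs M
  have : Nonempty U := (nonempty_prod.1 γ.nonempty).2
  set κ := (γ : Measure (S × U)).condKernel
  have hdis : (γ : Measure (S × U)).fst ⊗ₘ κ = γ :=
    (γ : Measure (S × U)).disintegrate κ
  have hκ : Measurable fun s => κ s (M.feasible s) := Kernel.measurable_kernel_prodMk_left hK
  have hG : MeasurableSet {s | κ s (M.feasible s) = 1} := hκ (measurableSet_singleton 1)
  have hae : ∀ᵐ s ∂(γ : Measure (S × U)).fst, κ s (M.feasible s) = 1 := by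
    have h : ∀ᵐ p ∂((γ : Measure (S × U)).fst ⊗ₘ κ), p.2 ∈ M.feasible p.1 := by
      rw [hdis]
      exact hγ
    filter_upwards [Measure.ae_ae_of_ae_compProd h] with s hs
    exact (prob_compl_eq_zero_iff (measurableSet_feasible M s)).1 hs
  -- The conditional kernel is feasible only almost everywhere; `φ₀` replaces it on the exceptional
  -- null set.
  let η := Kernel.piecewise hG κ φ₀.1
  have hη : IsMarkovKernel η := inferInstance
  refine ⟨⟨η, hη, fun s => ?_⟩, Subtype.ext ?_⟩
  · rw [Kernel.piecewise_apply]
    split_ifs with h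
    · exact h
    · exact φ₀.2.2 s
  · change (γ : Measure (S × U)).fst ⊗ₘ η = γ
    rw [← hdis, Measure.fst_compProd]
    refine Measure.compProd_congr ?_
    filter_upwards [hae] with s hs
    exact if_pos hs

/-- The laws on the feasible pairs with a given first marginal form a compact set. -/
theorem isCompact_setOf_map_fst_eq [StandardBorelSpace S] (hK : M.CompactOverCompacts)
    (ν : ProbabilityMeasure S) :
    IsCompact {γ : ProbabilityMeasure (S × U) | γ.map measurable_fst.aemeasurable = ν ∧
      (γ : Measure (S × U)) {p | p.2 ∈ M.feasible p.1}ᶜ = 0} := by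
  obtain ⟨u, -, u_pos, u_lim⟩ : ∃ u : ℕ → NNReal, StrictAnti u ∧ (∀ n, 0 < u n) ∧
      Filter.Tendsto u Filter.atTop (𝓝 0) := exists_seq_strictAnti_tendsto 0
  have ht := isTightMeasureSet_iff_exists_isCompact_measure_compl_le.1
    (isTightMeasureSet_singleton_of_standardBorelSpace (ν : Measure S))
  have hC : ∀ n, ∃ C : Set S, IsCompact C ∧ (ν : Measure S) Cᶜ ≤ u n := fun n => by
    obtain ⟨C, hC, hCu⟩ := ht (u n) (by exact_mod_cast u_pos n)
    exact ⟨C, hC, hCu _ rfl⟩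
  choose C hC hCu using hC
  -- Compact by `hK`. For laws with marginal `ν`, the bounds `γ (D n)ᶜ ≤ u n` for all `n` amount to
  -- feasibility: leaving `D n` means being infeasible or having state outside `C n`, and `u n`
  -- tends to `0`.
  let D : ℕ → Set (S × U) := fun n => {p | p.2 ∈ M.feasible p.1 ∧ p.1 ∈ C n}
  have hcomp := isCompact_setOfPred_probabilityMeasure_mass_eq_compl_isCompact_le u_lim
    (fun n => hK (C n) (hC n)) (Or.inl inferInstance)
  have hcl : IsClosed {γ : ProbabilityMeasure (S × U) |
      γ.map measurable_fst.aemeasurable = ν} :=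
    isClosed_eq (ProbabilityMeasure.continuous_map continuous_fst) continuous_const
  convert! hcomp.inter_left hcl using 1
  ext γ
  refine and_congr_right fun hγ => ?_
  have hfst : ∀ n, (γ : Measure (S × U)) (Prod.fst ⁻¹' (C n)ᶜ) = (ν : Measure S) (C n)ᶜ := fun n => by
    rw [← hγ, ProbabilityMeasure.map_apply' _ _ (hC n).measurableSet.compl]
  have hle : ∀ n, γ (D n)ᶜ ≤ u n ↔ (γ : Measure (S × U)) (D n)ᶜ ≤ u n := fun n => by
    rw [← ProbabilityMeasure.ennreal_coeFn_eq_coeFn_toMeasure, ENNReal.coe_le_coe]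
  change _ ↔ ∀ n, γ (D n)ᶜ ≤ u n
  simp only [hle]
  constructor
  · intro h n
    have hsub : (D n)ᶜ ⊆ {p : S × U | p.2 ∈ M.feasible p.1}ᶜ ∪ Prod.fst ⁻¹' (C n)ᶜ := by
      intro p hp
      by_cases h1 : p.2 ∈ M.feasible p.1
      · exact Or.inr fun h2 => hp ⟨h1, h2⟩
      · exact Or.inl h1
    calc (γ : Measure (S × U)) (D n)ᶜ ≤ _ := measure_mono hsub
      _ ≤ _ := measure_union_le _ _
      _ ≤ u n := by rw [h, hfst, zero_add]; exact hCu n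
  · intro h
    have h0 : ∀ n, (γ : Measure (S × U)) {p | p.2 ∈ M.feasible p.1}ᶜ ≤ u n := fun n =>
      (measure_mono (Set.compl_subset_compl.2 fun p hp => hp.1)).trans (h n)
    have hlim : Filter.Tendsto (fun n => (u n : ℝ≥0∞)) Filter.atTop (𝓝 0) := by
      rw [← ENNReal.coe_zero]
      exact ENNReal.tendsto_coe.2 u_lim
    exact le_antisymm (ge_of_tendsto' hlim h0) bot_le

theorem isInducing_jointLaw (ν : ProbabilityMeasure S) :
    @IsInducing _ _ (actionTopology (liftTopology M) ν) _ fun φ => jointLaw M ν φ := by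
  let _ := actionTopology (liftTopology M) ν
  exact ⟨induced_compose⟩

/-- An inducing map with compact range has a compact domain. The range is identified by
disintegration, which needs some rule to start from; without any rule the space is empty. -/
theorem compactSpace_decisionRule [StandardBorelSpace S] [StandardBorelSpace U]
    (hK : M.CompactOverCompacts) (ν : ProbabilityMeasure S) :
    @CompactSpace (DecisionRule M) (actionTopology (liftTopology M) ν) := by
  let _ := actionTopology (liftTopology M) ν
  rcases isEmpty_or_nonempty (DecisionRule M) with h | ⟨⟨φ₀⟩⟩
  · infer_instance
  refine ⟨(isInducing_jointLaw M ν).isCompact_iff.2 ?_⟩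
  convert! isCompact_setOf_map_fst_eq M hK ν using 1
  ext γ
  constructor
  · rintro ⟨φ, -, rfl⟩
    exact ⟨map_fst_jointLaw M ν φ, jointLaw_compl_feasiblePairs M ν φ⟩
  · rintro ⟨rfl, h⟩
    obtain ⟨φ, hφ⟩ := exists_jointLaw_eq M φ₀ γ h
    exact ⟨φ, Set.mem_univ _, hφ⟩

theorem upperSemicontinuous_liftReward (hr : M.RewardRegular)
    (hbelow : BddBelow (Set.range M.reward)) :
    @UpperSemicontinuous _ _ (liftTopology M) _
      fun p : ProbabilityMeasure S × DecisionRule M => liftReward M p.1 p.2 := by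
  let _ := liftTopology M
  exact (ProbabilityMeasure.upperSemicontinuous_integral hr.upperSemicontinuous hr.bddAbove
    hbelow).comp (continuous_pairProbability M)

theorem continuous_transition (hQ : M.StronglyContinuous) :
    @Continuous _ _ (liftTopology M) _
      fun p : ProbabilityMeasure S × DecisionRule M => transition M p.1 p.2 := by
  let _ := liftTopology M
  have hκ : ∀ g : BoundedContinuousFunction S ℝ, Continuous fun k => ∫ y, g y ∂(M.kernel k) :=
    fun g => (hQ g g.continuous.measurable ⟨‖g‖, fun x => g.norm_coe_le_norm x⟩).1
  have h := ProbabilityMeasure.continuous_bind M.kernel hκ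
  have h2 := h.comp (continuous_pairProbability M)
  refine h2.congr fun p => Subtype.ext ?_
  rfl

theorem exists_abs_liftReward_le (hr : M.RewardRegular) (hbelow : BddBelow (Set.range M.reward)) :
    ∃ C, ∀ ν φ, |liftReward M ν φ| ≤ C := by
  obtain ⟨b, hb⟩ := hr.bddAbove
  obtain ⟨a, ha⟩ := hbelow
  refine ⟨max |a| |b|, fun ν φ => ?_⟩
  have h := norm_integral_le_of_norm_le_const (μ := pairLaw M ν φ) (C := max |a| |b|)
    (f := M.reward) (Filter.Eventually.of_forall fun k =>
      abs_le_max_abs_abs (ha ⟨k, rfl⟩) (hb ⟨k, rfl⟩))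
  rw [probReal_univ, mul_one] at h
  exact h

end MarkovDecision.StandardModel

/-! ### Finite values, measurable choice of rules, and the measurized model. -/

namespace MarkovDecision

set_option linter.unusedSectionVars false

namespace DecisionModel.Policy

/-- A policy has finite value if the rewards are bounded and discounted. -/
theorem value_lt_top_of_abs_reward_le {X A : Type*} [MeasurableSpace X]
    {τ : TopologicalSpace (X × A)} {M : DecisionModel X A τ} (π : M.Policy) {α : ℝ}
    (hα₀ : 0 ≤ α) (hα₁ : α < 1) {C : ℝ} (hC : ∀ k, |M.reward k| ≤ C) (x : X) :
    ⊥ < π.value α x ∧ π.value α x < ⊤ := by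
  have : IsProbabilityMeasure (π.initial x) := by
    unfold initial
    infer_instance
  have : IsProbabilityMeasure (π.pathLaw x) := by
    unfold pathLaw
    infer_instance
  -- This geometric series dominates both the positive and the negative part, so the value is a
  -- difference of finite numbers.
  have hsum : ∑' t : ℕ, ENNReal.ofReal (α ^ t * C) ≠ ⊤ :=
    ((summable_geometric_of_lt_one hα₀ hα₁).mul_right C).tsum_ofReal_ne_top
  have hfin : ∀ f : ℕ → (ℕ → M.K) → ℝ, (∀ t ω, f t ω ≤ α ^ t * C) →
      ∫⁻ ω, ∑' t, ENNReal.ofReal (f t ω) ∂(π.pathLaw x) ≠ ⊤ := fun f hf => by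
    refine ne_top_of_le_ne_top hsum ?_
    calc ∫⁻ ω, ∑' t, ENNReal.ofReal (f t ω) ∂(π.pathLaw x)
        ≤ ∫⁻ _, ∑' t : ℕ, ENNReal.ofReal (α ^ t * C) ∂(π.pathLaw x) :=
          lintegral_mono fun ω => ENNReal.tsum_le_tsum fun t => ENNReal.ofReal_le_ofReal (hf t ω)
      _ = _ := by simp
  have h1 := hfin (fun t ω => α ^ t * M.reward (ω t)) fun t ω =>
    mul_le_mul_of_nonneg_left ((le_abs_self _).trans (hC _)) (pow_nonneg hα₀ t)
  have h2 := hfin (fun t ω => -(α ^ t * M.reward (ω t))) fun t ω => by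
    rw [← mul_neg]
    exact mul_le_mul_of_nonneg_left ((neg_le_abs _).trans (hC _)) (pow_nonneg hα₀ t)
  unfold value
  lift (∫⁻ ω, ∑' t, ENNReal.ofReal (α ^ t * M.reward (ω t)) ∂(π.pathLaw x)) to NNReal using h1 with a
  lift (∫⁻ ω, ∑' t, ENNReal.ofReal (-(α ^ t * M.reward (ω t))) ∂(π.pathLaw x)) to NNReal
    using h2 with b
  have h : ((a : ℝ≥0∞) : EReal) - ((b : ℝ≥0∞) : EReal) = (((a : ℝ) - (b : ℝ) : ℝ) : EReal) := rfl
  rw [h]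
  exact ⟨EReal.bot_lt_coe _, EReal.coe_lt_top _⟩

end DecisionModel.Policy

namespace StandardModel

variable {S : Type*} {U : Type*}
  [TopologicalSpace S] [MetrizableSpace S] [SecondCountableTopology S] [MeasurableSpace S]
  [BorelSpace S] [StandardBorelSpace S]
  [TopologicalSpace U] [MetrizableSpace U] [SecondCountableTopology U] [MeasurableSpace U]
  [BorelSpace U] [StandardBorelSpace U]
  (M : StandardModel S U)

/-- Measurable selection of decision rules from closed sets `Φ(ν)` with a Borel graph. -/
theorem exists_measurable_jointLaw (hK : M.CompactOverCompacts)
    (feas : ProbabilityMeasure S → Set (DecisionRule M)) (hne : ∀ ν, (feas ν).Nonempty)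
    (hmeas : MeasurableSet[@borel _ (liftTopology M)]
      {p : ProbabilityMeasure S × DecisionRule M | p.2 ∈ feas p.1})
    (hclosed : ∀ ν, IsClosed[actionTopology (liftTopology M) ν] (feas ν)) :
    ∃ φ : ProbabilityMeasure S → DecisionRule M, (∀ ν, φ ν ∈ feas ν) ∧
      Measurable fun ν => jointLaw M ν (φ ν) := by
  rw [liftTopology, borel_comap, ← BorelSpace.measurable_eq] at hmeas
  -- A Borel set of pairs is a preimage under the joint law, so feasibility of `φ` at `ν` depends on
  -- the joint law alone.
  obtain ⟨D, hD, hDf⟩ := hmeas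
  have hDf' : ∀ ν φ, jointLaw M ν φ ∈ D ↔ φ ∈ feas ν := fun ν φ =>
    (Set.ext_iff.1 hDf (ν, φ) : _)
  obtain ⟨f, hf⟩ := exists_isEmbedding_hilbertCube (S × U)
  let J : ProbabilityMeasure (S × U) → ProbabilityMeasure (ℕ → unitInterval) :=
    fun γ => γ.map hf.continuous.measurable.aemeasurable
  have hJc : Continuous J := ProbabilityMeasure.continuous_map hf.continuous
  have hJ : MeasurableEmbedding J := ProbabilityMeasure.measurableEmbedding_map_of_isEmbedding hf
  let p : ProbabilityMeasure (S × U) → ProbabilityMeasure S :=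
    fun γ => γ.map measurable_fst.aemeasurable
  have hp : Continuous p := ProbabilityMeasure.continuous_map continuous_fst
  let E : Set (ProbabilityMeasure (S × U)) :=
    D ∩ {γ | (γ : Measure (S × U)) {p | p.2 ∈ M.feasible p.1}ᶜ = 0}
  have hE : MeasurableSet E := by
    refine hD.inter ?_
    exact (Measure.measurable_coe (measurableSet_feasiblePairs M).compl).comp
      measurable_subtype_coe (measurableSet_singleton 0)
  -- The selection takes place among joint laws, embedded by `J` in a compact metrizable space. `C`
  -- is Borel as an injective measurable image of a Borel set, and its sections are continuous
  -- images of the compact sets `feas ν`.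
  let C : Set (ProbabilityMeasure S × ProbabilityMeasure (ℕ → unitInterval)) :=
    (fun γ => (p γ, J γ)) '' E
  have : MeasurableSpace.CountablySeparated
      (ProbabilityMeasure S × ProbabilityMeasure (ℕ → unitInterval)) :=
    MeasurableSpace.countablySeparated_of_separatesPoints
  have hC : MeasurableSet C := hE.image_of_measurable_injOn (hp.measurable.prodMk hJ.measurable)
    fun γ _ γ' _ h => hJ.injective (Prod.ext_iff.1 h).2
  have hsec : ∀ ν, {y | (ν, y) ∈ C} = (fun φ => J (jointLaw M ν φ)) '' feas ν := by
    intro ν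
    ext y
    constructor
    · rintro ⟨γ, ⟨hγD, hγ⟩, h⟩
      obtain ⟨rfl, rfl⟩ := Prod.ext_iff.1 h
      obtain ⟨φ₀, -⟩ := hne (p γ)
      obtain ⟨φ, hφ⟩ := exists_jointLaw_eq M φ₀ γ hγ
      have hφ' : jointLaw M (p γ) φ = γ := hφ
      refine ⟨φ, (hDf' _ _).1 (by rwa [hφ']), ?_⟩
      dsimp only
      rw [hφ']
    · rintro ⟨φ, hφ, rfl⟩
      exact ⟨jointLaw M ν φ, ⟨(hDf' _ _).2 hφ, jointLaw_compl_feasiblePairs M ν φ⟩,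
        Prod.ext (map_fst_jointLaw M ν φ) rfl⟩
  have hcl : ∀ ν, IsClosed {y | (ν, y) ∈ C} := by
    intro ν
    rw [hsec]
    let _ := actionTopology (liftTopology M) ν
    have := compactSpace_decisionRule M hK ν
    exact ((hclosed ν).isCompact.image (hJc.comp (isInducing_jointLaw M ν).continuous)).isClosed
  obtain ⟨g, hg, hgC⟩ := exists_measurable_selection_of_isClosed_sections hC hcl fun ν => by
    rw [hsec]
    exact (hne ν).image _
  have hφ : ∀ ν, ∃ φ ∈ feas ν, J (jointLaw M ν φ) = g ν := fun ν => by
    have h : g ν ∈ {y | (ν, y) ∈ C} := hgC ν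
    rwa [hsec] at h
  -- The rules themselves are chosen arbitrarily; only their joint laws have to be measurable.
  choose φ hφ hφg using hφ
  refine ⟨φ, hφ, hJ.measurable_comp_iff.1 ?_⟩
  have h : J ∘ (fun ν => jointLaw M ν (φ ν)) = g := funext hφg
  rwa [h]

section Measurized

variable (feas : ProbabilityMeasure S → Set (DecisionRule M)) (hne : ∀ ν, (feas ν).Nonempty)
  (hmeas : MeasurableSet[@borel _ (liftTopology M)]
    {p : ProbabilityMeasure S × DecisionRule M | p.2 ∈ feas p.1})

theorem measurized_rewardRegular (hr : M.RewardRegular) (hbelow : BddBelow (Set.range M.reward))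
    (hK : M.CompactOverCompacts)
    (hclosed : ∀ ν, IsClosed[actionTopology (liftTopology M) ν] (feas ν)) :
    (measurized M feas hne hmeas).RewardRegular where
  upperSemicontinuous := by
    let _ := liftTopology M
    exact (upperSemicontinuous_liftReward M hr hbelow).comp continuous_subtype_val
  bddAbove := by
    obtain ⟨C, hC⟩ := exists_abs_liftReward_le M hr hbelow
    refine ⟨C, ?_⟩
    rintro - ⟨k, rfl⟩
    exact (le_abs_self _).trans (hC k.1.1 k.1.2)
  supCompact := fun ν c => by
    have h1 := compactSpace_decisionRule M hK ν
    have h2 : IsClosed[actionTopology (liftTopology M) ν] {φ | c ≤ liftReward M ν φ} := by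
      let _ := liftTopology M
      let _ := actionTopology (liftTopology M) ν
      have hc : Continuous fun φ : DecisionRule M => (ν, φ) := continuous_induced_dom
      exact ((upperSemicontinuous_liftReward M hr hbelow).comp hc).isClosed_preimage c
    let _ := actionTopology (liftTopology M) ν
    convert! ((hclosed ν).inter h2).isCompact using 1
    ext φ
    exact ⟨fun ⟨h, h'⟩ => ⟨h, h'⟩, fun ⟨h, h'⟩ => ⟨h, h'⟩⟩

theorem measurized_weaklyContinuous (hQ : M.StronglyContinuous) :
    (measurized M feas hne hmeas).WeaklyContinuous := by
  rintro g hg ⟨C, hC⟩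
  have h : ∀ k : (measurized M feas hne hmeas).K,
      ∫ y, g y ∂((measurized M feas hne hmeas).kernel k) = g (transition M k.1.1 k.1.2) := fun k => by
    change ∫ y, g y ∂(Measure.dirac (transition M k.1.1 k.1.2)) = _
    exact integral_dirac' _ _ hg.measurable.stronglyMeasurable
  simp only [h]
  refine ⟨?_, C, fun k => hC _⟩
  let _ := liftTopology M
  exact hg.comp ((continuous_transition M hQ).comp continuous_subtype_val)

/-- The measurized model has a policy if the sets `Φ(ν)` are closed. -/
theorem nonempty_measurized_policy (hK : M.CompactOverCompacts)
    (hclosed : ∀ ν, IsClosed[actionTopology (liftTopology M) ν] (feas ν)) :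
    Nonempty (measurized M feas hne hmeas).Policy := by
  obtain ⟨φ, hφ, hφm⟩ := exists_measurable_jointLaw M hK feas hne hmeas hclosed
  let c : ProbabilityMeasure S → (measurized M feas hne hmeas).K := fun ν => ⟨(ν, φ ν), hφ ν⟩
  have hind : @IsInducing (measurized M feas hne hmeas).K _ _ _
      fun k => jointLaw M k.1.1 k.1.2 := ⟨induced_compose⟩
  -- The σ-algebra on the feasible pairs is pulled back along the joint law, so measurability of the
  -- joint law is enough.
  have hc : Measurable c := by
    rw [measurable_iff_comap_le]
    change MeasurableSpace.comap c (borel _) ≤ _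
    rw [hind.eq_induced, borel_comap, ← BorelSpace.measurable_eq, MeasurableSpace.comap_comp]
    exact hφm.comap_le
  -- The state is the first marginal of the joint law, hence a continuous function of the pair. The
  -- measurability is needed to evaluate the Dirac mass in `state_eq`.
  have hstate : ∀ ν : ProbabilityMeasure S,
      MeasurableSet {k : (measurized M feas hne hmeas).K | k.1.1 = ν} := fun ν => by
    have hcont : Continuous fun k : (measurized M feas hne hmeas).K =>
        (jointLaw M k.1.1 k.1.2).map (f := Prod.fst) measurable_fst.aemeasurable :=
      (ProbabilityMeasure.continuous_map continuous_fst).comp hind.continuous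
    simp only [map_fst_jointLaw] at hcont
    exact (isClosed_eq hcont continuous_const).measurableSet
  exact ⟨{
    act := fun t => Kernel.deterministic (fun h => c h.2) (hc.comp measurable_snd)
    isMarkovKernel := fun t => Kernel.isMarkovKernel_deterministic _
    state_eq := fun t h => by
      rw [Kernel.deterministic_apply, ae_dirac_iff (hstate h.2)] }⟩

end Measurized

end StandardModel
end MarkovDecision

theorem proposition3p2 {S : Type*} {U : Type*}
    [TopologicalSpace S] [TopologicalSpace.MetrizableSpace S] [SecondCountableTopology S]
    [MeasurableSpace S] [BorelSpace S] [StandardBorelSpace S]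
    [TopologicalSpace U] [TopologicalSpace.MetrizableSpace U] [SecondCountableTopology U]
    [MeasurableSpace U] [BorelSpace U] [StandardBorelSpace U]
    (α : ℝ) (hα₀ : 0 ≤ α) (hα₁ : α < 1)
    (M : MarkovDecision.StandardModel S U)
    (hr : M.RewardRegular) (hQ : M.StronglyContinuous) (hV : M.HasFiniteValuePolicy α)
    (hbelow : BddBelow (Set.range M.reward)) (hK : M.CompactOverCompacts)
    (feas : MeasureTheory.ProbabilityMeasure S →
      Set (MarkovDecision.StandardModel.DecisionRule M))
    (hne : ∀ ν, (feas ν).Nonempty)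
    (hmeas : MeasurableSet[@borel _ (MarkovDecision.StandardModel.liftTopology M)]
      {p : MeasureTheory.ProbabilityMeasure S × MarkovDecision.StandardModel.DecisionRule M |
        p.2 ∈ feas p.1})
    (hclosed : ∀ ν, IsClosed[MarkovDecision.actionTopology
      (MarkovDecision.StandardModel.liftTopology M) ν] (feas ν)) :
    (MarkovDecision.StandardModel.measurized M feas hne hmeas).RewardRegular ∧
    (MarkovDecision.StandardModel.measurized M feas hne hmeas).WeaklyContinuous ∧
    ∃ π : (MarkovDecision.StandardModel.measurized M feas hne hmeas).Policy,
      ∀ ν, ⊥ < π.value α ν ∧ π.value α ν < ⊤ := by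
  refine ⟨M.measurized_rewardRegular feas hne hmeas hr hbelow hK hclosed,
    M.measurized_weaklyContinuous feas hne hmeas hQ, ?_⟩
  obtain ⟨π⟩ := M.nonempty_measurized_policy feas hne hmeas hK hclosed
  obtain ⟨C, hC⟩ := M.exists_abs_liftReward_le hr hbelow
  exact ⟨π, π.value_lt_top_of_abs_reward_le hα₀ hα₁ fun k => hC k.1.1 k.1.2⟩
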